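/- Let $X$ be an analytically finite Riemann surface of type $(g,m)$, i.e. biholomorphic to a closed Riemann surface of genus $g$ with $m$ points removed, where $m\ge 4$ if $g=0$ and $m\ge 1$ if $g=1$; it underlies a point $x=(X,f)$ of the Teichmüller space $\mathcal T_{g,m}$. Let $A^2(X)$ be the space of holomorphic quadratic differentials $\varphi=\varphi(z)\,dz^2$ on $X$ with $\|\varphi\|_1=\int_X|\varphi(z)|\,dx\,dy<\infty$, let $L^\infty(X)$ be the space of bounded measurable $(-1,1)$-forms on $X$, and let $N^\infty(X)=\{\mu\in L^\infty(X) : \int_X\mu\varphi=0 \text{ for all } \varphi\in A^2(X)\}$. The tangent space is $T_x\mathcal T_{g,m}=L^\infty(X)/N^\infty(X)$; for $v=[\mu]$ in it and $\varphi\in A^2(X)$ put $\langle v,\varphi\rangle=\int_X\mu\varphi$, and let $$\kappa(v)=\sup\{\operatorname{Re}\langle v,\varphi\rangle : \varphi\in A^2(X),\ \|\varphi\|_1=1\}$$ be the Teichmüller metric. Let $\omega$ be a real $1$-form which at $x$ is represented by $\psi\in A^2(X)$, i.e. $\omega(v)=\operatorname{Re}\langle v,\psi\rangle$ for all $v\in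 T_x\mathcal T_{g,m}$, and suppose that $\|\psi\|_1<1$. Let $\kappa^\omega(v)=\kappa(v)+\omega(v)$ be the Teichmüller–Randers metric, and for $\varphi\in A^2(X)$ let $$G_\omega(\varphi)=\sup\{\operatorname{Re}\langle v,\varphi\rangle : v\in T_x\mathcal T_{g,m},\ \kappa^\omega(v)=1\}$$ be the dual Teichmüller–Randers cometric. Then for every $\varphi\in A^2(X)$ the values in this supremum are bounded above, and $$G_\omega(\varphi)=\inf\left\{t>0 : \left\|\frac{\varphi}{t}-\psi\right\|_1\le 1\right\}.$$ In particular, if $\varphi\neq 0$, then $$\left\|\frac{\varphi}{G_\omega(\varphi)}-\psi\right\|_1=1.$$ -/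

import Mathlib

open scoped Manifold

noncomputable section

namespace TeichmullerRanders

/-! ### Riemann surfaces of type `(g, m)`

A Riemann surface is a connected, Hausdorff, second countable space with charts in `ℂ` whose
coordinate changes are holomorphic: `IsManifold 𝓘(ℂ) 1` says that they are continuously complex
differentiable, which is the same. -/

/-- A closed surface `M` has genus `g` when `H₁(M; ℤ)`, the abelianized fundamental group, is
free abelian of rank `2g`. -/
def HasGenus (M : Type*) [TopologicalSpace M] (g : ℕ) : Prop :=
  ∀ p : M, Nonempty
    (Additive (Abelianization (FundamentalGroup M p)) ≃+ (Fin (2 * g) → ℤ))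

/-- `X` is analytically finite of type `(g, m)`: it is biholomorphic to a closed Riemann surface
of genus `g` with `m` points removed. -/
def IsOfType.{u} (X : Type u) [TopologicalSpace X] [ChartedSpace ℂ X] (g m : ℕ) : Prop :=
  ∃ (M : Type u) (_ : TopologicalSpace M) (_ : T2Space M) (_ : CompactSpace M)
    (_ : ConnectedSpace M) (_ : ChartedSpace ℂ M) (_ : IsManifold 𝓘(ℂ) 1 M),
    HasGenus M g ∧
      ∃ j : X → M, Topology.IsOpenEmbedding j ∧ MDifferentiable 𝓘(ℂ) 𝓘(ℂ) j ∧
        (Set.range j)ᶜ.encard = m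

variable {X : Type*} [TopologicalSpace X] [ChartedSpace ℂ X]

/-! ### Differentials in local coordinates

A `(p, q)`-differential on `X` is recorded by the function `X → ℂ` whose value at `x` is its
coefficient at `x` in the preferred chart `chartAt ℂ x`. Its coefficient in an arbitrary
holomorphic chart is computed by the transformation law of its type. -/

/-- The derivative at `z` of the change from the coordinate `e` to the preferred coordinate at the
point `e⁻¹(z)`. -/
def coordDeriv (e : OpenPartialHomeomorph X ℂ) (z : ℂ) : ℂ :=
  deriv (fun w => chartAt ℂ (e.symm z) (e.symm w)) z

/-- The coefficient `φ(z)` of the quadratic differential `φ = φ(z) dz²` in the chart `e`. -/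
def quadCoeff (φ : X → ℂ) (e : OpenPartialHomeomorph X ℂ) (z : ℂ) : ℂ :=
  φ (e.symm z) * coordDeriv e z ^ 2

/-- The coefficient `μ(z)` of the `(-1,1)`-form `μ = μ(z) dz̄/dz` in the chart `e`. -/
def beltramiCoeff (μ : X → ℂ) (e : OpenPartialHomeomorph X ℂ) (z : ℂ) : ℂ :=
  μ (e.symm z) * ((starRingEnd ℂ) (coordDeriv e z) / coordDeriv e z)

/-! ### Integration over a Riemann surface

Integrals of densities over `X` are computed by cutting `X` into countably many pairwise disjoint
Borel pieces, each contained in one chart, and integrating in the coordinate of that chart. -/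

section Integration

variable [SecondCountableTopology X]

theorem exists_chart_cover [Nonempty X] :
    ∃ c : ℕ → X, ⋃ i, (chartAt ℂ (c i)).source = Set.univ := by
  obtain ⟨s, hs, hU⟩ := TopologicalSpace.countable_cover_nhds
    (fun x : X => (chartAt ℂ x).open_source.mem_nhds (mem_chart_source ℂ x))
  have hne : s.Nonempty := by
    rw [Set.nonempty_iff_ne_empty]
    rintro rfl
    simp at hU
    exact Set.empty_ne_univ hU
  obtain ⟨c, rfl⟩ := hs.exists_eq_range hne
  exact ⟨c, by simpa using hU⟩

variable (X) in
/-- A sequence of charts of `X` whose domains cover `X`. -/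
def coverChart [Nonempty X] (i : ℕ) : OpenPartialHomeomorph X ℂ :=
  chartAt ℂ ((exists_chart_cover (X := X)).choose i)

variable (X) in
/-- The `i`-th piece, seen in its coordinate: the points of the `i`-th chart domain that lie in no
earlier one. -/
def tile [Nonempty X] (i : ℕ) : Set ℂ :=
  {z ∈ (coverChart X i).target | ∀ j < i, (coverChart X i).symm z ∉ (coverChart X j).source}

/-- `∫_X |φ| dx dy`, as an element of `[0, ∞]`. -/
def quadMass [Nonempty X] (φ : X → ℂ) : ENNReal :=
  ∑' i, ∫⁻ z in tile X i, ‖quadCoeff φ (coverChart X i) z‖ₑ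

/-- `∫_X μ φ = ∫_X μ(z) φ(z) dx dy`. -/
def beltramiIntegral [Nonempty X] (μ φ : X → ℂ) : ℂ :=
  ∑' i, ∫ z in tile X i,
    beltramiCoeff μ (coverChart X i) z * quadCoeff φ (coverChart X i) z

end Integration

/-! ### Auxiliary facts needed for the linear structures -/

theorem quadCoeff_add (φ χ : X → ℂ) (e : OpenPartialHomeomorph X ℂ) :
    quadCoeff (φ + χ) e = quadCoeff φ e + quadCoeff χ e := by
  ext z; simp [quadCoeff, add_mul]

theorem quadCoeff_smul (a : ℂ) (φ : X → ℂ) (e : OpenPartialHomeomorph X ℂ) :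
    quadCoeff (a • φ) e = a • quadCoeff φ e := by
  ext z; simp [quadCoeff, mul_assoc]

theorem quadCoeff_zero (e : OpenPartialHomeomorph X ℂ) :
    quadCoeff (0 : X → ℂ) e = 0 := by
  ext z; simp [quadCoeff]

theorem beltramiCoeff_add (μ ν : X → ℂ) (e : OpenPartialHomeomorph X ℂ) :
    beltramiCoeff (μ + ν) e = beltramiCoeff μ e + beltramiCoeff ν e := by
  ext z; simp [beltramiCoeff, add_mul]

theorem beltramiCoeff_smul (a : ℂ) (μ : X → ℂ) (e : OpenPartialHomeomorph X ℂ) :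
    beltramiCoeff (a • μ) e = a • beltramiCoeff μ e := by
  ext z; simp [beltramiCoeff, mul_assoc]

theorem beltramiCoeff_zero (e : OpenPartialHomeomorph X ℂ) :
    beltramiCoeff (0 : X → ℂ) e = 0 := by
  ext z; simp [beltramiCoeff]

section Spaces

variable [SecondCountableTopology X] [Nonempty X]

theorem measurableSet_tile (i : ℕ) : MeasurableSet (tile X i) := by
  have h : tile X i = (coverChart X i).target \
      ⋃ j ∈ Set.Iio i, ((coverChart X i).target ∩
        (coverChart X i).symm ⁻¹' (coverChart X j).source) := by
    ext z
    simp only [tile, Set.mem_ofPred_eq, Set.mem_sdiff, Set.mem_iUnion, Set.mem_Iio, Set.mem_inter_iff,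
      Set.mem_preimage, exists_prop, not_exists, not_and]
    exact ⟨fun h => ⟨h.1, fun j hj _ => h.2 j hj⟩, fun h => ⟨h.1, fun j hj => h.2 j hj h.1⟩⟩
  rw [h]
  refine (coverChart X i).open_target.measurableSet.diff ?_
  refine MeasurableSet.biUnion (Set.to_countable _) fun j _ => ?_
  exact ((coverChart X i).isOpen_inter_preimage_symm (coverChart X j).open_source).measurableSet

theorem tile_subset (i : ℕ) : tile X i ⊆ (coverChart X i).target := fun _ h => h.1

theorem coverChart_mem [IsManifold 𝓘(ℂ) 1 X] (i : ℕ) :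
    coverChart X i ∈ IsManifold.maximalAtlas 𝓘(ℂ) 1 X :=
  IsManifold.chart_mem_maximalAtlas _

variable (X) in
/-- `A²(X)`: the holomorphic quadratic differentials with finite `∫_X |φ| dx dy`. -/
def A2 [IsManifold 𝓘(ℂ) 1 X] : Submodule ℂ (X → ℂ) where
  carrier := {φ | (∀ e ∈ IsManifold.maximalAtlas 𝓘(ℂ) 1 X,
    DifferentiableOn ℂ (quadCoeff φ e) e.target) ∧ quadMass φ < ⊤}
  zero_mem' := by
    refine ⟨fun e _ => ?_, ?_⟩
    · rw [quadCoeff_zero]; exact differentiableOn_const 0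
    · simp [quadMass, quadCoeff_zero]
  add_mem' := by
    rintro φ χ ⟨hφ, hφ'⟩ ⟨hχ, hχ'⟩
    refine ⟨fun e he => ?_, ?_⟩
    · rw [quadCoeff_add]; exact (hφ e he).add (hχ e he)
    · refine lt_of_le_of_lt ?_ (ENNReal.add_lt_top.2 ⟨hφ', hχ'⟩)
      rw [quadMass, quadMass, quadMass, ← ENNReal.tsum_add]
      refine ENNReal.tsum_le_tsum fun i => ?_
      rw [← MeasureTheory.lintegral_add_left']
      · refine MeasureTheory.lintegral_mono fun z => ?_
        rw [quadCoeff_add]; exact enorm_add_le _ _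
      · exact (((hφ _ (coverChart_mem i)).continuousOn.mono (tile_subset i)).aestronglyMeasurable
          (measurableSet_tile i)).enorm
  smul_mem' := by
    rintro a φ ⟨hφ, hφ'⟩
    refine ⟨fun e he => ?_, ?_⟩
    · rw [quadCoeff_smul]; exact (hφ e he).const_smul a
    · have h : quadMass (a • φ) = ‖a‖ₑ * quadMass φ := by
        rw [quadMass, quadMass, ← ENNReal.tsum_mul_left]
        refine tsum_congr fun i => ?_
        rw [← MeasureTheory.lintegral_const_mul' _ _ (by simp)]
        simp [quadCoeff_smul]
      change quadMass (a • φ) < ⊤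
      rw [h]
      exact ENNReal.mul_lt_top (by simp) hφ'

/-- `‖φ‖₁ = ∫_X |φ| dx dy`. -/
def norm1 [IsManifold 𝓘(ℂ) 1 X] (φ : A2 X) : ℝ := (quadMass (φ : X → ℂ)).toReal

variable (X) in
/-- `L^∞(X)`: the bounded measurable `(-1,1)`-forms. Forms that agree almost everywhere are
identified only in the quotient `TangentSpaceAt` below. -/
def Linf [IsManifold 𝓘(ℂ) 1 X] : Submodule ℂ (X → ℂ) where
  carrier := {μ | (∀ e ∈ IsManifold.maximalAtlas 𝓘(ℂ) 1 X,
      Measurable (e.target.indicator (beltramiCoeff μ e))) ∧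
    ∃ C : ℝ, ∀ e ∈ IsManifold.maximalAtlas 𝓘(ℂ) 1 X, ∀ z ∈ e.target, ‖beltramiCoeff μ e z‖ ≤ C}
  zero_mem' := by
    refine ⟨fun e _ => ?_, 0, fun e _ z _ => ?_⟩
    · rw [beltramiCoeff_zero]; exact measurable_const.indicator e.open_target.measurableSet
    · simp [beltramiCoeff_zero]
  add_mem' := by
    rintro μ ν ⟨hμ, C, hC⟩ ⟨hν, D, hD⟩
    refine ⟨fun e he => ?_, C + D, fun e he z hz => ?_⟩
    · rw [beltramiCoeff_add, Set.indicator_add']; exact (hμ e he).add (hν e he)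
    · rw [beltramiCoeff_add]
      exact (norm_add_le _ _).trans (add_le_add (hC e he z hz) (hD e he z hz))
  smul_mem' := by
    rintro a μ ⟨hμ, C, hC⟩
    refine ⟨fun e he => ?_, ‖a‖ * C, fun e he z hz => ?_⟩
    · rw [beltramiCoeff_smul]
      have h : e.target.indicator (a • beltramiCoeff μ e)
          = a • e.target.indicator (beltramiCoeff μ e) := by
        ext z; by_cases hz : z ∈ e.target <;> simp [hz]
      rw [h]; exact (hμ e he).const_smul a
    · rw [beltramiCoeff_smul, Pi.smul_apply, norm_smul]
      exact mul_le_mul_of_nonneg_left (hC e he z hz) (norm_nonneg a)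

variable [IsManifold 𝓘(ℂ) 1 X]

theorem integrableOn_mul (μ : Linf X) (φ : A2 X) (i : ℕ) :
    MeasureTheory.IntegrableOn (fun z => beltramiCoeff (μ : X → ℂ) (coverChart X i) z *
      quadCoeff (φ : X → ℂ) (coverChart X i) z) (tile X i) := by
  obtain ⟨hμ, C, hC⟩ := μ.2
  obtain ⟨hφ, hφ'⟩ := φ.2
  have hi := coverChart_mem (X := X) i
  have hint : MeasureTheory.IntegrableOn (quadCoeff (φ : X → ℂ) (coverChart X i)) (tile X i) := by
    refine ⟨((hφ _ hi).continuousOn.mono (tile_subset i)).aestronglyMeasurable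
      (measurableSet_tile i), ?_⟩
    exact lt_of_le_of_lt (ENNReal.le_tsum i) hφ'
  refine MeasureTheory.Integrable.bdd_mul (c := C) hint ?_ ?_
  · refine MeasureTheory.AEStronglyMeasurable.congr
      (hμ _ hi).aestronglyMeasurable ?_
    refine (MeasureTheory.ae_restrict_iff' (measurableSet_tile i)).2 (.of_forall fun z hz => ?_)
    exact Set.indicator_of_mem (tile_subset i hz) _
  · exact (MeasureTheory.ae_restrict_iff' (measurableSet_tile i)).2
      (.of_forall fun z hz => hC _ hi z (tile_subset i hz))

theorem summable_mul (μ : Linf X) (φ : A2 X) :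
    Summable fun i => ∫ z in tile X i, beltramiCoeff (μ : X → ℂ) (coverChart X i) z *
      quadCoeff (φ : X → ℂ) (coverChart X i) z := by
  obtain ⟨hμ, C, hC⟩ := μ.2
  obtain ⟨hφ, hφ'⟩ := φ.2
  have hs := (ENNReal.summable_toReal (ne_of_lt hφ')).mul_left C
  refine Summable.of_norm_bounded hs fun i => ?_
  have hi := coverChart_mem (X := X) i
  have hfin : ∫⁻ z in tile X i, ‖quadCoeff (φ : X → ℂ) (coverChart X i) z‖ₑ < ⊤ :=
    lt_of_le_of_lt (ENNReal.le_tsum i) hφ'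
  have hm : MeasureTheory.AEStronglyMeasurable (quadCoeff (φ : X → ℂ) (coverChart X i))
      (MeasureTheory.volume.restrict (tile X i)) :=
    ((hφ _ hi).continuousOn.mono (tile_subset i)).aestronglyMeasurable (measurableSet_tile i)
  have hint : MeasureTheory.IntegrableOn (quadCoeff (φ : X → ℂ) (coverChart X i)) (tile X i) :=
    ⟨hm, hfin⟩
  rw [← MeasureTheory.integral_norm_eq_lintegral_enorm hm, ← MeasureTheory.integral_const_mul]
  refine MeasureTheory.norm_integral_le_of_norm_le (hint.norm.const_mul C) ?_
  refine (MeasureTheory.ae_restrict_iff' (measurableSet_tile i)).2 (.of_forall fun z hz => ?_)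
  rw [norm_mul]
  exact mul_le_mul_of_nonneg_right (hC _ hi z (tile_subset i hz)) (norm_nonneg _)

/-- The pairing `(μ, φ) ↦ ∫_X μ φ` of `L^∞(X)` with `A²(X)`. -/
def pairing : Linf X →ₗ[ℂ] A2 X →ₗ[ℂ] ℂ :=
  LinearMap.mk₂ ℂ (fun μ φ => beltramiIntegral (μ : X → ℂ) (φ : X → ℂ))
    (fun μ ν φ => by
      rw [beltramiIntegral, beltramiIntegral, beltramiIntegral,
        ← (summable_mul μ φ).tsum_add (summable_mul ν φ)]
      refine tsum_congr fun i => ?_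
      rw [← MeasureTheory.integral_add (integrableOn_mul μ φ i) (integrableOn_mul ν φ i)]
      simp [beltramiCoeff_add, add_mul])
    (fun a μ φ => by
      rw [beltramiIntegral, beltramiIntegral, smul_eq_mul, ← tsum_mul_left]
      refine tsum_congr fun i => ?_
      rw [← MeasureTheory.integral_const_mul]
      simp [beltramiCoeff_smul, mul_assoc])
    (fun μ φ χ => by
      rw [beltramiIntegral, beltramiIntegral, beltramiIntegral,
        ← (summable_mul μ φ).tsum_add (summable_mul μ χ)]
      refine tsum_congr fun i => ?_
      rw [← MeasureTheory.integral_add (integrableOn_mul μ φ i) (integrableOn_mul μ χ i)]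
      simp [quadCoeff_add, mul_add])
    (fun a μ φ => by
      rw [beltramiIntegral, beltramiIntegral, smul_eq_mul, ← tsum_mul_left]
      refine tsum_congr fun i => ?_
      rw [← MeasureTheory.integral_const_mul]
      simp [quadCoeff_smul, mul_left_comm])

variable (X) in
/-- `N^∞(X)`: the Beltrami differentials `μ` with `∫_X μ φ = 0` for all `φ ∈ A²(X)`. -/
def Ninf : Submodule ℂ (Linf X) := LinearMap.ker (pairing (X := X))

variable (X) in
/-- The tangent space of Teichmüller space at a point `(X, f)`: the quotient
`L^∞(X) / N^∞(X)`. -/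
abbrev TangentSpaceAt : Type _ := Linf X ⧸ Ninf X

/-- The pairing `⟨v, φ⟩ = ∫_X μ φ`, where `v = [μ]`. -/
def tangentPairing (v : TangentSpaceAt X) (φ : A2 X) : ℂ :=
  (Ninf X).liftQ pairing le_rfl v φ

/-- The Teichmüller metric `κ(v) = sup { Re ⟨v, φ⟩ : ‖φ‖₁ = 1 }`. -/
def teichmullerMetric (v : TangentSpaceAt X) : ℝ :=
  sSup {r | ∃ φ : A2 X, norm1 φ = 1 ∧ r = (tangentPairing v φ).re}

/-- The real covector `ω` is represented by `ψ`: `ω(v) = Re ⟨v, ψ⟩` for all `v`. -/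
def IsRepresentedBy (ω : TangentSpaceAt X →ₗ[ℝ] ℝ) (ψ : A2 X) : Prop :=
  ∀ v, ω v = (tangentPairing v ψ).re

/-- The Teichmüller–Randers metric `κ^ω(v) = κ(v) + ω(v)`. -/
def randersMetric (ω : TangentSpaceAt X →ₗ[ℝ] ℝ) (v : TangentSpaceAt X) : ℝ :=
  teichmullerMetric v + ω v

/-- The values `Re ⟨v, φ⟩` on the indicatrix `κ^ω(v) = 1`. -/
def indicatrixValues (ω : TangentSpaceAt X →ₗ[ℝ] ℝ) (φ : A2 X) : Set ℝ :=
  {r | ∃ v : TangentSpaceAt X, randersMetric ω v = 1 ∧ r = (tangentPairing v φ).re}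

/-- The Teichmüller–Randers cometric `G_ω(φ) = sup { Re ⟨v, φ⟩ : κ^ω(v) = 1 }`. -/
def cometric (ω : TangentSpaceAt X →ₗ[ℝ] ℝ) (φ : A2 X) : ℝ :=
  sSup (indicatrixValues ω φ)

end Spaces

end TeichmullerRanders

end

namespace TeichmullerRanders

open MeasureTheory

section Coordinates

variable {X : Type*} [TopologicalSpace X] [ChartedSpace ℂ X]

/-! The cometric is a support function, and adding `ω` to `κ` translates the dual unit ball by `ψ`.
For `t > 0` put `χ = φ/t - ψ`, so that `Re⟨v,φ⟩ = t (Re⟨v,χ⟩ + ω(v))`. If `‖χ‖₁ ≤ 1`, then `Re⟨v,χ⟩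
≤ κ(v)`, so on the indicatrix `κ + ω = 1` the pairing with `φ` is at most `t`
(`mem_upperBounds_indicatrixValues`). If `‖χ‖₁ = 1`, the bound is attained: the Beltrami form
`|χ|/χ` has `κ = 1` and pairs with `χ` to `1`, and `‖ψ‖₁ < 1` makes `κ + ω` positive on it, so it
can be rescaled onto the indicatrix (`mem_indicatrixValues`).

For `φ ≠ 0` the intermediate value theorem gives such a `t` (`exists_norm1_inv_smul_sub_eq_one`).
This `t` is the greatest value on the indicatrix, and also the least admissible parameter, since
every admissible parameter bounds all the values. -/

theorem exists_mem_coverChart_source [SecondCountableTopology X] [Nonempty X]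
    (x : X) : ∃ i, x ∈ (coverChart X i).source := by
  have h : x ∈ ⋃ i, (chartAt ℂ ((exists_chart_cover (X := X)).choose i)).source := by
    rw [(exists_chart_cover (X := X)).choose_spec]; trivial
  simpa [coverChart] using h

/-- The Beltrami form `|χ| / χ`, taken to be `0` at the zeros of `χ`. -/
noncomputable def extremalForm (χ : X → ℂ) (x : X) : ℂ := (starRingEnd ℂ) (χ x) / ‖χ x‖

/-- With `d` the coordinate derivative, the factor `conj(d)² / |d|²` produced by `χ` equals `conj(d)
/ d`, the factor of a `(-1,1)`-form. Where something vanishes, both sides are `0` because division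
by zero gives `0`. -/
theorem beltramiCoeff_extremalForm (χ : X → ℂ) (e : OpenPartialHomeomorph X ℂ) (z : ℂ) :
    beltramiCoeff (extremalForm χ) e z =
      (starRingEnd ℂ) (quadCoeff χ e z) / ‖quadCoeff χ e z‖ := by
  simp only [beltramiCoeff, extremalForm, quadCoeff]
  set d := coordDeriv e z
  rcases eq_or_ne d 0 with hd | hd
  · simp [hd]
  have hd' : (starRingEnd ℂ) d ≠ 0 := by simpa using hd
  have hn : ((‖d‖ : ℂ)) ^ 2 = (starRingEnd ℂ) d * d := (Complex.conj_mul' d).symm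
  rw [norm_mul, norm_pow, map_mul, map_pow, Complex.ofReal_mul, Complex.ofReal_pow, hn]
  rcases eq_or_ne (χ (e.symm z)) 0 with h0 | h0
  · simp [h0]
  have h0' : (‖χ (e.symm z)‖ : ℂ) ≠ 0 := by simpa using h0
  field_simp

theorem differentiableAt_coordChange {e e' : OpenPartialHomeomorph X ℂ}
    (he : e ∈ IsManifold.maximalAtlas 𝓘(ℂ) 1 X) (he' : e' ∈ IsManifold.maximalAtlas 𝓘(ℂ) 1 X)
    {z : ℂ} (hz : z ∈ e.target) (hz' : e.symm z ∈ e'.source) :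
    DifferentiableAt ℂ (fun w => e' (e.symm w)) z := by
  have h : ContDiffOn ℂ 1 (e.symm.trans e') (e.symm.trans e').source := by
    have h := (contDiffGroupoid 1 𝓘(ℂ)).compatible_of_mem_maximalAtlas he he'
    rw [contDiffGroupoid, mem_groupoid_of_pregroupoid] at h
    simpa [contDiffPregroupoid, Function.comp_def] using h.1
  have hmem : z ∈ (e.symm.trans e').source := by
    simp [hz, hz']
  exact (h.differentiableOn one_ne_zero).differentiableAt
    ((e.symm.trans e').open_source.mem_nhds hmem)

/-- The coordinate change has a differentiable local inverse, so by the chain rule its derivative is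
a factor of `1`. -/
theorem coordDeriv_ne_zero [IsManifold 𝓘(ℂ) 1 X] {e : OpenPartialHomeomorph X ℂ}
    (he : e ∈ IsManifold.maximalAtlas 𝓘(ℂ) 1 X) {z : ℂ} (hz : z ∈ e.target) :
    coordDeriv e z ≠ 0 := by
  set c := chartAt ℂ (e.symm z) with hc
  have hcm : c ∈ IsManifold.maximalAtlas 𝓘(ℂ) 1 X := IsManifold.chart_mem_maximalAtlas _
  have hzc : e.symm z ∈ c.source := mem_chart_source ℂ _
  have h1 : DifferentiableAt ℂ (fun w => c (e.symm w)) z :=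
    differentiableAt_coordChange he hcm hz hzc
  have h2 : DifferentiableAt ℂ (fun w => e (c.symm w)) (c (e.symm z)) :=
    differentiableAt_coordChange hcm he (c.map_source hzc) (by
      rw [c.left_inv hzc]; exact e.map_target hz)
  have hcomp : HasDerivAt (fun w => e (c.symm (c (e.symm w))))
      (deriv (fun w => e (c.symm w)) (c (e.symm z)) * deriv (fun w => c (e.symm w)) z) z :=
    HasDerivAt.comp (h₂ := fun w => e (c.symm w)) z h2.hasDerivAt h1.hasDerivAt
  have hid : (fun w => e (c.symm (c (e.symm w)))) =ᶠ[nhds z] id := by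
    have hmem : z ∈ (e.symm.trans c).source := by simp [hz, hzc]
    filter_upwards [(e.symm.trans c).open_source.mem_nhds hmem] with w hw
    have hw' : w ∈ e.target ∧ e.symm w ∈ c.source := by simpa using hw
    rw [c.left_inv hw'.2, e.right_inv hw'.1, id]
  have hone := (hcomp.congr_of_eventuallyEq hid.symm).unique (hasDerivAt_id z)
  intro h0
  change deriv (fun w => c (e.symm w)) z = 0 at h0
  rw [h0, mul_zero] at hone
  exact zero_ne_one hone

end Coordinates

variable {X : Type*} [TopologicalSpace X] [ChartedSpace ℂ X] [SecondCountableTopology X]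
  [Nonempty X] [IsManifold 𝓘(ℂ) 1 X]

/-! ### The norm on `A²(X)` -/

theorem aestronglyMeasurable_quadCoeff (φ : A2 X) (i : ℕ) :
    AEStronglyMeasurable (quadCoeff (φ : X → ℂ) (coverChart X i))
      (volume.restrict (tile X i)) :=
  ((φ.2.1 _ (coverChart_mem i)).continuousOn.mono (tile_subset i)).aestronglyMeasurable
    (measurableSet_tile i)

theorem integrableOn_quadCoeff (φ : A2 X) (i : ℕ) :
    IntegrableOn (quadCoeff (φ : X → ℂ) (coverChart X i)) (tile X i) :=
  ⟨aestronglyMeasurable_quadCoeff φ i, lt_of_le_of_lt (ENNReal.le_tsum i) φ.2.2⟩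

theorem hasSum_norm1 (φ : A2 X) :
    HasSum (fun i => ∫ z in tile X i, ‖quadCoeff (φ : X → ℂ) (coverChart X i) z‖) (norm1 φ) := by
  simp_rw [integral_norm_eq_lintegral_enorm (aestronglyMeasurable_quadCoeff φ _)]
  have h := ENNReal.hasSum_toReal φ.2.2.ne
  rwa [← ENNReal.tsum_toReal_eq fun i => (lt_of_le_of_lt (ENNReal.le_tsum i) φ.2.2).ne] at h

theorem norm1_nonneg (φ : A2 X) : 0 ≤ norm1 φ := ENNReal.toReal_nonneg

theorem norm1_add_le (φ χ : A2 X) : norm1 (φ + χ) ≤ norm1 φ + norm1 χ := by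
  refine hasSum_le (fun i => ?_) (hasSum_norm1 (φ + χ)) ((hasSum_norm1 φ).add (hasSum_norm1 χ))
  rw [← integral_add (integrableOn_quadCoeff φ i).norm (integrableOn_quadCoeff χ i).norm]
  refine integral_mono (integrableOn_quadCoeff (φ + χ) i).norm
    ((integrableOn_quadCoeff φ i).norm.add (integrableOn_quadCoeff χ i).norm) fun z => ?_
  simp only [Submodule.coe_add, quadCoeff_add, Pi.add_apply]
  exact norm_add_le _ _

theorem norm1_smul (a : ℂ) (φ : A2 X) : norm1 (a • φ) = ‖a‖ * norm1 φ := by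
  refine (hasSum_norm1 (a • φ)).unique ?_
  refine ((hasSum_norm1 φ).mul_left ‖a‖).congr_fun fun i => ?_
  rw [← integral_const_mul]
  simp [quadCoeff_smul]

theorem norm1_neg (φ : A2 X) : norm1 (-φ) = norm1 φ := by
  have h := norm1_smul (-1) φ
  rwa [show (-1 : ℂ) • φ = -φ from neg_one_smul ℂ φ, norm_neg, norm_one, one_mul] at h

theorem norm1_zero : norm1 (0 : A2 X) = 0 := by
  simpa using norm1_smul 0 (0 : A2 X)

/-- A tile need not be open, so positivity of the integral is not immediate. In the first chart
where `φ` is not identically zero, the nonvanishing set is open and lies entirely in the tile, hence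
has positive measure. -/
theorem norm1_eq_zero {φ : A2 X} (h : norm1 φ = 0) : φ = 0 := by
  classical
  by_contra hne
  have hex : ∃ i, ∃ x ∈ (coverChart X i).source, (φ : X → ℂ) x ≠ 0 := by
    by_contra! hall
    refine hne (Subtype.ext (funext fun x => ?_))
    obtain ⟨i, hi⟩ := exists_mem_coverChart_source x
    exact hall i x hi
  set i := Nat.find hex with hi
  obtain ⟨x, hx, hφx⟩ := Nat.find_spec hex
  have hmin : ∀ j < i, ∀ y ∈ (coverChart X j).source, (φ : X → ℂ) y = 0 := by
    intro j hj
    simpa using Nat.find_min hex hj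
  set e := coverChart X i with he
  set U : Set ℂ := e.target ∩ quadCoeff (φ : X → ℂ) e ⁻¹' {0}ᶜ with hU
  have hUo : IsOpen U :=
    (φ.2.1 e (coverChart_mem i)).continuousOn.isOpen_inter_preimage e.open_target
      isOpen_compl_singleton
  have hUne : e x ∈ U := by
    refine ⟨e.map_source hx, ?_⟩
    have := coordDeriv_ne_zero (coverChart_mem (X := X) i) (e.map_source hx)
    simp only [Set.mem_preimage, Set.mem_compl_iff, Set.mem_singleton_iff, quadCoeff,
      e.left_inv hx]
    exact mul_ne_zero hφx (pow_ne_zero 2 this)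
  -- The points removed from the chart to form the tile lie in earlier charts, where `φ` vanishes.
  have hUt : U ⊆ tile X i := by
    rintro z ⟨hz, hzφ⟩
    refine ⟨hz, fun j hj hmem => hzφ ?_⟩
    have : (φ : X → ℂ) (e.symm z) = 0 := hmin j hj _ hmem
    simp [quadCoeff, this]
  have hzero : ∫⁻ z in tile X i, ‖quadCoeff (φ : X → ℂ) e z‖ₑ = 0 := by
    have hq : quadMass (φ : X → ℂ) = 0 :=
      ((ENNReal.toReal_eq_zero_iff _).1 h).resolve_right φ.2.2.ne
    exact ENNReal.tsum_eq_zero.1 hq i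
  have hae := (lintegral_eq_zero_iff' (aestronglyMeasurable_quadCoeff φ i).enorm).1 hzero
  have hae' := (ae_restrict_iff' (measurableSet_tile i)).1 hae
  have hvol : volume U = 0 := by
    refine measure_mono_null (fun z hz => ?_) hae'
    intro hcon
    have := hcon (hUt hz)
    exact hz.2 (by simpa using this)
  exact (hUo.measure_pos volume ⟨_, hUne⟩).ne' hvol

/-! ### The pairing and the Teichmüller metric -/

theorem tangentPairing_mk (μ : Linf X) (φ : A2 X) :
    tangentPairing (Submodule.Quotient.mk μ) φ =
      beltramiIntegral (μ : X → ℂ) (φ : X → ℂ) := rfl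

theorem tangentPairing_add_right (v : TangentSpaceAt X) (φ χ : A2 X) :
    tangentPairing v (φ + χ) = tangentPairing v φ + tangentPairing v χ :=
  map_add ((Ninf X).liftQ pairing le_rfl v) φ χ

theorem tangentPairing_smul_right (v : TangentSpaceAt X) (a : ℂ) (φ : A2 X) :
    tangentPairing v (a • φ) = a * tangentPairing v φ :=
  map_smul ((Ninf X).liftQ pairing le_rfl v) a φ

theorem tangentPairing_smul_left (a : ℂ) (v : TangentSpaceAt X) (φ : A2 X) :
    tangentPairing (a • v) φ = a * tangentPairing v φ := by
  simp [tangentPairing]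

theorem re_tangentPairing_real_smul (v : TangentSpaceAt X) (a : ℝ) (φ : A2 X) :
    (tangentPairing v ((a : ℂ) • φ)).re = a * (tangentPairing v φ).re := by
  rw [tangentPairing_smul_right, Complex.re_ofReal_mul]

/-- `|∫_X μ φ| ≤ ‖μ‖_∞ ‖φ‖₁`. -/
theorem norm_beltramiIntegral_le {μ : Linf X} {C : ℝ}
    (hC : ∀ e ∈ IsManifold.maximalAtlas 𝓘(ℂ) 1 X, ∀ z ∈ e.target,
      ‖beltramiCoeff (μ : X → ℂ) e z‖ ≤ C) (φ : A2 X) :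
    ‖beltramiIntegral (μ : X → ℂ) (φ : X → ℂ)‖ ≤ C * norm1 φ := by
  refine tsum_of_norm_bounded ((hasSum_norm1 φ).mul_left C) fun i => ?_
  rw [← integral_const_mul]
  refine norm_integral_le_of_norm_le ((integrableOn_quadCoeff φ i).norm.const_mul C) ?_
  refine (ae_restrict_iff' (measurableSet_tile i)).2 (.of_forall fun z hz => ?_)
  rw [norm_mul]
  exact mul_le_mul_of_nonneg_right (hC _ (coverChart_mem i) z (tile_subset i hz)) (norm_nonneg _)

theorem bddAbove_re_tangentPairing (v : TangentSpaceAt X) :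
    BddAbove {r | ∃ φ : A2 X, norm1 φ = 1 ∧ r = (tangentPairing v φ).re} := by
  obtain ⟨μ, rfl⟩ := Submodule.Quotient.mk_surjective _ v
  obtain ⟨C, hC⟩ := μ.2.2
  refine ⟨C, ?_⟩
  rintro r ⟨φ, hφ, rfl⟩
  refine (Complex.re_le_norm _).trans ?_
  rw [tangentPairing_mk]
  simpa [hφ] using norm_beltramiIntegral_le hC φ

theorem re_tangentPairing_le (v : TangentSpaceAt X) (φ : A2 X) :
    (tangentPairing v φ).re ≤ teichmullerMetric v * norm1 φ := by
  rcases (norm1_nonneg φ).eq_or_lt with h0 | h0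
  · have : φ = 0 := norm1_eq_zero h0.symm
    have hp : tangentPairing v (0 : A2 X) = 0 := map_zero ((Ninf X).liftQ pairing le_rfl v)
    rw [this, hp, norm1_zero]
    simp
  · have h1 : norm1 (((norm1 φ)⁻¹ : ℝ) • (φ : A2 X) : A2 X) = 1 := by
      have := norm1_smul (((norm1 φ)⁻¹ : ℝ) : ℂ) φ
      rw [Complex.norm_real, Real.norm_of_nonneg (by positivity), inv_mul_cancel₀ h0.ne'] at this
      exact this
    have h2 := le_csSup (bddAbove_re_tangentPairing v)
      ⟨(((norm1 φ)⁻¹ : ℝ) : ℂ) • φ, h1, rfl⟩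
    rw [re_tangentPairing_real_smul, inv_mul_le_iff₀ h0, mul_comm] at h2
    exact h2

theorem teichmullerMetric_smul {s : ℝ} (hs : 0 ≤ s) (v : TangentSpaceAt X) :
    teichmullerMetric ((s : ℂ) • v) = s * teichmullerMetric v := by
  rw [teichmullerMetric, teichmullerMetric, ← smul_eq_mul, ← Real.sSup_smul_of_nonneg hs]
  congr 1
  ext r
  simp only [Set.mem_smul_set, Set.mem_ofPred_eq, tangentPairing_smul_left, Complex.re_ofReal_mul,
    smul_eq_mul]
  constructor
  · rintro ⟨φ, hφ, rfl⟩
    exact ⟨_, ⟨φ, hφ, rfl⟩, rfl⟩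
  · rintro ⟨_, ⟨φ, hφ, rfl⟩, rfl⟩
    exact ⟨φ, hφ, rfl⟩

/-! ### The extremal Beltrami form of a quadratic differential -/

theorem norm_conj_div_norm_le (q : ℂ) : ‖(starRingEnd ℂ) q / ‖q‖‖ ≤ 1 := by
  simpa using div_self_le_one ‖q‖

theorem extremalForm_mem_Linf (χ : A2 X) : extremalForm (χ : X → ℂ) ∈ Linf X := by
  refine ⟨fun e he => ?_, 1, fun e _ z _ => ?_⟩
  · have hq : Measurable (e.target.indicator (quadCoeff (χ : X → ℂ) e)) := by
      classical
      rw [← Set.piecewise_eq_indicator]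
      exact (χ.2.1 e he).continuousOn.measurable_piecewise continuousOn_const
        e.open_target.measurableSet
    have heq : e.target.indicator (beltramiCoeff (extremalForm (χ : X → ℂ)) e) =
        fun z => (starRingEnd ℂ) (e.target.indicator (quadCoeff (χ : X → ℂ) e) z) /
          ‖e.target.indicator (quadCoeff (χ : X → ℂ) e) z‖ := by
      ext z
      by_cases hz : z ∈ e.target <;> simp [hz, beltramiCoeff_extremalForm]
    rw [heq]
    exact (Complex.continuous_conj.measurable.comp hq).div
      (Complex.measurable_ofReal.comp hq.norm)
  · rw [beltramiCoeff_extremalForm]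
    exact norm_conj_div_norm_le _

theorem beltramiIntegral_extremalForm (χ : A2 X) :
    beltramiIntegral (extremalForm (χ : X → ℂ)) (χ : X → ℂ) = norm1 χ := by
  rw [beltramiIntegral, ← (hasSum_norm1 χ).tsum_eq, Complex.ofReal_tsum]
  refine tsum_congr fun i => ?_
  rw [← integral_complex_ofReal]
  refine integral_congr_ae (.of_forall fun z => ?_)
  simp only [beltramiCoeff_extremalForm]
  set q := quadCoeff (χ : X → ℂ) (coverChart X i) z
  rcases eq_or_ne q 0 with h | h
  · simp [h]
  · have hq : (‖q‖ : ℂ) ≠ 0 := by simpa using h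
    rw [div_mul_eq_mul_div, Complex.conj_mul', sq, mul_div_assoc, div_self hq, mul_one]

/-- A quadratic differential of norm `1` is paired to `1` by a tangent vector of length `1`. -/
theorem exists_teichmullerMetric_eq_one {χ : A2 X} (hχ : norm1 χ = 1) :
    ∃ v : TangentSpaceAt X, teichmullerMetric v = 1 ∧ (tangentPairing v χ).re = 1 := by
  set μ : Linf X := ⟨extremalForm (χ : X → ℂ), extremalForm_mem_Linf χ⟩
  have hv : (tangentPairing (Submodule.Quotient.mk μ) χ).re = 1 := by
    rw [tangentPairing_mk, beltramiIntegral_extremalForm, hχ]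
    simp
  refine ⟨Submodule.Quotient.mk μ, le_antisymm ?_ ?_, hv⟩
  · refine csSup_le ⟨_, χ, hχ, rfl⟩ ?_
    rintro r ⟨φ, hφ, rfl⟩
    refine (Complex.re_le_norm _).trans ?_
    rw [tangentPairing_mk]
    have h := norm_beltramiIntegral_le (μ := μ) (C := 1)
      (fun e _ z _ => by
        rw [beltramiCoeff_extremalForm]; exact norm_conj_div_norm_le _) φ
    simpa [hφ] using h
  · simpa [hχ, hv] using re_tangentPairing_le (Submodule.Quotient.mk μ) χ

/-! ### The cometric -/

variable {ω : TangentSpaceAt X →ₗ[ℝ] ℝ} {ψ φ : A2 X}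

/-- Pairing with `φ = t ((φ/t - ψ) + ψ)` isolates the term that becomes `ω(v)`. -/
theorem re_tangentPairing_eq (v : TangentSpaceAt X) (ψ φ : A2 X) {t : ℝ} (ht : t ≠ 0) :
    (tangentPairing v φ).re =
      t * ((tangentPairing v ((t : ℂ)⁻¹ • φ - ψ)).re + (tangentPairing v ψ).re) := by
  rw [← Complex.add_re, ← tangentPairing_add_right, sub_add_cancel, ← Complex.ofReal_inv,
    re_tangentPairing_real_smul, mul_inv_cancel_left₀ ht]

theorem neg_re_tangentPairing_le (v : TangentSpaceAt X) (φ : A2 X) :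
    -(tangentPairing v φ).re ≤ teichmullerMetric v * norm1 φ := by
  have h := re_tangentPairing_le v (-φ)
  rwa [norm1_neg, show tangentPairing v (-φ) = -tangentPairing v φ from
    map_neg ((Ninf X).liftQ pairing le_rfl v) φ, Complex.neg_re] at h

/-- Both `Re⟨v,χ⟩` and its negative are at most `κ(v)`. -/
theorem teichmullerMetric_nonneg_of_norm1_eq_one {χ : A2 X} (hχ : norm1 χ = 1)
    (v : TangentSpaceAt X) : 0 ≤ teichmullerMetric v := by
  have h1 := re_tangentPairing_le v χ
  have h2 := neg_re_tangentPairing_le v χ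
  rw [hχ] at h1 h2
  linarith

theorem teichmullerMetric_nonneg (v : TangentSpaceAt X) : 0 ≤ teichmullerMetric v := by
  by_cases h : ∃ χ : A2 X, norm1 χ = 1
  · exact teichmullerMetric_nonneg_of_norm1_eq_one h.choose_spec v
  -- With no differential of norm `1`, the supremum is over the empty set, which is `0` by
  -- convention.
  · refine Real.sSup_nonneg ?_
    rintro r ⟨χ, hχ, -⟩
    exact absurd ⟨χ, hχ⟩ h

theorem mem_upperBounds_indicatrixValues (hω : IsRepresentedBy ω ψ) {t : ℝ} (ht : 0 < t)
    (h : norm1 ((t : ℂ)⁻¹ • φ - ψ) ≤ 1) : t ∈ upperBounds (indicatrixValues ω φ) := by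
  rintro r ⟨v, hv, rfl⟩
  rw [randersMetric, hω v] at hv
  rw [re_tangentPairing_eq v ψ φ ht.ne']
  have h1 := re_tangentPairing_le v ((t : ℂ)⁻¹ • φ - ψ)
  have h2 := mul_le_mul_of_nonneg_left h (teichmullerMetric_nonneg v)
  calc _ ≤ t * 1 := mul_le_mul_of_nonneg_left (by linarith) ht.le
    _ = t := mul_one t

theorem mem_indicatrixValues (hω : IsRepresentedBy ω ψ) (hψ : norm1 ψ < 1) {t : ℝ} (ht : 0 < t)
    (h : norm1 ((t : ℂ)⁻¹ • φ - ψ) = 1) : t ∈ indicatrixValues ω φ := by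
  obtain ⟨v, hv, hvχ⟩ := exists_teichmullerMetric_eq_one h
  have hlow : -(tangentPairing v ψ).re ≤ norm1 ψ := by
    simpa [hv] using neg_re_tangentPairing_le v ψ
  -- This is `κ(v) + ω(v)`; it is at least `1 - ‖ψ‖₁ > 0`, so dividing `v` by it lands on the
  -- indicatrix.
  set k : ℝ := 1 + (tangentPairing v ψ).re with hk
  have hkpos : 0 < k := by linarith
  refine ⟨((k⁻¹ : ℝ) : ℂ) • v, ?_, ?_⟩
  · rw [randersMetric, hω, teichmullerMetric_smul (by positivity), tangentPairing_smul_left,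
      Complex.re_ofReal_mul, hv, ← mul_add, ← hk, inv_mul_cancel₀ hkpos.ne']
  · rw [tangentPairing_smul_left, Complex.re_ofReal_mul, re_tangentPairing_eq v ψ φ ht.ne', hvχ,
      ← hk]
    field_simp

/-- By the triangle inequality the function is Lipschitz with constant `‖φ‖₁`. -/
theorem continuous_norm1_smul_sub (φ ψ : A2 X) :
    Continuous fun s : ℝ => norm1 ((s : ℂ) • φ - ψ) := by
  have key : ∀ s t : ℝ, norm1 ((s : ℂ) • φ - ψ) ≤
      norm1 ((t : ℂ) • φ - ψ) + norm1 φ * dist s t := by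
    intro s t
    have h : (s : ℂ) • φ - ψ = ((t : ℂ) • φ - ψ) + ((s - t : ℝ) : ℂ) • φ := by
      rw [Complex.ofReal_sub, show ((s : ℂ) - t) • φ = (s : ℂ) • φ - (t : ℂ) • φ from
        sub_smul (s : ℂ) t φ]
      abel
    calc _ ≤ _ := h ▸ norm1_add_le _ _
      _ = _ := by rw [norm1_smul, Complex.norm_real, mul_comm, Real.dist_eq, Real.norm_eq_abs]
  exact (LipschitzWith.of_le_add_mul' (norm1 φ) key).continuous

theorem exists_norm1_inv_smul_sub_eq_one (hψ : norm1 ψ < 1) (hφ : φ ≠ 0) :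
    ∃ t : ℝ, 0 < t ∧ norm1 ((t : ℂ)⁻¹ • φ - ψ) = 1 := by
  have hpos : 0 < norm1 φ := (norm1_nonneg φ).lt_of_ne fun h => hφ (norm1_eq_zero h.symm)
  -- In the variable `s = 1/t`, the norm is `‖ψ‖₁ < 1` at `s = 0`, and at `s = b` it is at least `2
  -- - ‖ψ‖₁ > 1`.
  set b : ℝ := 2 / norm1 φ
  have hb : 0 < b := by positivity
  have h0 : norm1 (((0 : ℝ) : ℂ) • φ - ψ) < 1 := by simpa [norm1_neg] using hψ
  have h1 : 1 ≤ norm1 ((b : ℂ) • φ - ψ) := by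
    have h := norm1_add_le ((b : ℂ) • φ - ψ) ψ
    rw [sub_add_cancel, norm1_smul, Complex.norm_real, Real.norm_of_nonneg hb.le,
      div_mul_cancel₀ _ hpos.ne'] at h
    linarith
  obtain ⟨s, hs, hs1⟩ := intermediate_value_Icc hb.le
    (continuous_norm1_smul_sub φ ψ).continuousOn ⟨h0.le, h1⟩
  have hs0 : 0 < s := hs.1.lt_of_ne fun h => by
    rw [← h] at hs1
    exact h0.ne hs1
  refine ⟨s⁻¹, inv_pos.2 hs0, ?_⟩
  rw [Complex.ofReal_inv, inv_inv]
  exact hs1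

theorem cometric_zero (ω : TangentSpaceAt X →ₗ[ℝ] ℝ) : cometric ω (0 : A2 X) = 0 := by
  have hval : ∀ r ∈ indicatrixValues ω (0 : A2 X), r = 0 := by
    rintro r ⟨v, -, rfl⟩
    have hp : tangentPairing v (0 : A2 X) = 0 := map_zero ((Ninf X).liftQ pairing le_rfl v)
    rw [hp, Complex.zero_re]
  -- Two inequalities, each valid also if the indicatrix is empty, when the supremum is `0` by
  -- convention.
  exact le_antisymm (Real.sSup_nonpos fun r hr => (hval r hr).le)
    (Real.sSup_nonneg fun r hr => (hval r hr).ge)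

end TeichmullerRanders

open TeichmullerRanders in
theorem mainTheorem6
    {X : Type*} [TopologicalSpace X] [T2Space X] [SecondCountableTopology X] [ConnectedSpace X]
    [ChartedSpace ℂ X] [IsManifold 𝓘(ℂ) 1 X]
    (g m : ℕ) (hg0 : g = 0 → 4 ≤ m) (hg1 : g = 1 → 1 ≤ m)
    (hX : TeichmullerRanders.IsOfType X g m)
    (ω : TeichmullerRanders.TangentSpaceAt X →ₗ[ℝ] ℝ) (ψ : TeichmullerRanders.A2 X)
    (hω : TeichmullerRanders.IsRepresentedBy ω ψ) (hψ : TeichmullerRanders.norm1 ψ < 1)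
    (φ : TeichmullerRanders.A2 X) :
    BddAbove (TeichmullerRanders.indicatrixValues ω φ) ∧
    TeichmullerRanders.cometric ω φ =
      sInf {t : ℝ | 0 < t ∧ TeichmullerRanders.norm1 ((t : ℂ)⁻¹ • φ - ψ) ≤ 1} ∧
    (φ ≠ 0 →
      TeichmullerRanders.norm1
        (((TeichmullerRanders.cometric ω φ : ℝ) : ℂ)⁻¹ • φ - ψ) = 1) := by
  rcases eq_or_ne φ 0 with rfl | hφ
  · have hn : ∀ t : ℝ, norm1 ((t : ℂ)⁻¹ • (0 : A2 X) - ψ) ≤ 1 := fun t => by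
      simpa [norm1_neg] using hψ.le
    refine ⟨⟨1, mem_upperBounds_indicatrixValues hω one_pos (hn 1)⟩, ?_, fun h => absurd rfl h⟩
    -- For `φ = 0` every `t > 0` is admissible, so the infimum is `0` and is not attained.
    have hset : {t : ℝ | 0 < t ∧ norm1 ((t : ℂ)⁻¹ • (0 : A2 X) - ψ) ≤ 1} = Set.Ioi 0 := by
      ext t
      simp only [Set.mem_ofPred_eq, hn t, and_true, Set.mem_Ioi]
    rw [hset, csInf_Ioi, cometric_zero]
  · obtain ⟨t, ht, h1⟩ := exists_norm1_inv_smul_sub_eq_one hψ hφ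
    have hmem := mem_indicatrixValues hω hψ ht h1
    have hub := mem_upperBounds_indicatrixValues hω ht h1.le
    have hc : cometric ω φ = t := IsGreatest.csSup_eq ⟨hmem, hub⟩
    have hl : IsLeast {t : ℝ | 0 < t ∧ norm1 ((t : ℂ)⁻¹ • φ - ψ) ≤ 1} t :=
      -- An admissible `s` bounds all indicatrix values, and `t` is one of them.
      ⟨⟨ht, h1.le⟩, fun s hs => mem_upperBounds_indicatrixValues hω hs.1 hs.2 hmem⟩
    refine ⟨⟨t, hub⟩, ?_, fun _ => ?_⟩
    · rw [hc, hl.csInf_eq]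
    · rw [hc, h1]
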